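/- Let $d\ge 2$ and let $\mathcal K_d$ be the set of convex compact subsets of $\mathbb R^d$ with non-empty interior, with the Hausdorff distance. An affine point is a continuous map $p:\mathcal K_d\to\mathbb R^d$ such that $p(T(C))=T(p(C))$ for every $C\in\mathcal K_d$ and every invertible affine map $T$ of $\mathbb R^d$. For affine points $p_1,p_2$ with $p_1(C),p_2(C)\in C$ for every $C\in\mathcal K_d$, define $$\phi_{p_1,p_2}(C)=\begin{cases}1 & \text{if } p_1(C)=p_2(C),\\ 1-\dfrac{\|p_1(C)-p_2(C)\|_2}{\mathrm{vol}_1(a\cap C)} & \text{otherwise,}\end{cases}$$ where $a$ is the line through $p_1(C)$ and $p_2(C)$ and $\mathrm{vol}_1$ denotes length. **Theorem.** For every $d\ge 2$ there are affine points $p_1,p_2$ with $p_1(C),p_2(C)\in C$ for every $C\in\mathcal K_d$, and a convex body $C\in\mathcal K_d$, such that $\phi_{p_1,p_2}(C)=0$. -/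

import Mathlib

/-- `d`-dimensional convex bodies: convex, compact subsets of Euclidean space `ℝᵈ` with non-empty
interior. As a subtype of `ConvexBody` it carries the Hausdorff distance. -/
abbrev SolidBody (d : ℕ) : Type :=
  {C : ConvexBody (EuclideanSpace ℝ (Fin d)) // (interior (C : Set (EuclideanSpace ℝ (Fin d)))).Nonempty}

namespace SolidBody

/-- The underlying set of points of a convex body. -/
def points {d : ℕ} (C : SolidBody d) : Set (EuclideanSpace ℝ (Fin d)) :=
  (C.1 : Set (EuclideanSpace ℝ (Fin d)))

/-- The image `T(C)` of a convex body under an invertible affine map `T` of `ℝᵈ`. -/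
def image {d : ℕ} (T : EuclideanSpace ℝ (Fin d) ≃ᵃ[ℝ] EuclideanSpace ℝ (Fin d))
    (C : SolidBody d) : SolidBody d :=
  ⟨{ carrier := T '' C.points
     convex' := C.1.convex.affine_image T.toAffineMap
     isCompact' := C.1.isCompact.image T.toAffineMap.continuous_of_finiteDimensional
     nonempty' := C.1.nonempty.image T }, by
    have h := (AffineEquiv.toContinuousAffineEquiv T).toHomeomorph.image_interior C.points
    exact (h ▸ Set.Nonempty.image _ C.2 :
      (interior ((AffineEquiv.toContinuousAffineEquiv T).toHomeomorph '' C.points)).Nonempty)⟩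

end SolidBody

/-- Affine invariant points: maps from convex bodies to `ℝᵈ`, continuous for the Hausdorff
distance and the Euclidean norm, with `p (T(C)) = T (p C)` for every invertible affine `T`. -/
structure IsAffinePoint {d : ℕ} (p : SolidBody d → EuclideanSpace ℝ (Fin d)) : Prop where
  continuous : Continuous p
  equivariant : ∀ (T : EuclideanSpace ℝ (Fin d) ≃ᵃ[ℝ] EuclideanSpace ℝ (Fin d)) (C : SolidBody d),
    p (C.image T) = T (p C)

open Classical in
/-- The number `δ(C)`: it is `0` if `p₁ C = p₂ C`, and otherwise `‖p₁ C - p₂ C‖ / vol₁ (a ∩ C)`,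
where `a` is the line through `p₁ C` and `p₂ C` and `vol₁` is length (one-dimensional
Hausdorff measure). -/
noncomputable def asymmetry {d : ℕ} (p₁ p₂ : SolidBody d → EuclideanSpace ℝ (Fin d))
    (C : SolidBody d) : ℝ :=
  if p₁ C = p₂ C then 0
  else ‖p₁ C - p₂ C‖ /
    (MeasureTheory.Measure.hausdorffMeasure 1
      ((affineSpan ℝ {p₁ C, p₂ C} : Set (EuclideanSpace ℝ (Fin d))) ∩ C.points)).toReal

/-- The symmetry measure `φ = 1 - δ` attached to `p₁` and `p₂`. -/
noncomputable def symmetryMeasure {d : ℕ} (p₁ p₂ : SolidBody d → EuclideanSpace ℝ (Fin d))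
    (C : SolidBody d) : ℝ :=
  1 - asymmetry p₁ p₂ C

open MeasureTheory Filter Topology Set

namespace SolidBody

variable {d : ℕ}

/-! It suffices to attach to each body, continuously and affinely, a vector `v` at its centroid `g`,
with `v ≠ 0` for at least one body. The two points are then sought where the rays from `g` in
directions `v` and `-v` leave the body; if they are both ends of a chord, the ratio of lengths is 1.
Exit points alone do not depend continuously on the body where `v = 0`, so the denominator, the
gauge of `±v`, is truncated below at a constant `δ > 0`. The gauge is affinely invariant, so
truncation preserves equivariance, and it only pulls the points towards `g`. Choosing `δ` as the
smaller gauge of `±v` at one body makes it harmless there (`line_inter_points_eq_segment`).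

The vector `skewVector` is an average of `x - g` with a weight built from the gauge of `g - x`. Its
continuity rests on `continuous_setIntegral` and `continuous_centralGauge`. It is nonzero for a cube
with one small corner cut off: the weight then lives only on the side of the opposite corner
(`skewVector_cutCube_ne_zero`). -/

lemma convex_points (C : SolidBody d) : Convex ℝ C.points := C.1.convex

lemma isCompact_points (C : SolidBody d) : IsCompact C.points := C.1.isCompact

lemma isClosed_points (C : SolidBody d) : IsClosed C.points := C.1.isCompact.isClosed

lemma measurableSet_points (C : SolidBody d) : MeasurableSet C.points :=
  C.isClosed_points.measurableSet

/-! ### Membership under Hausdorff perturbation -/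

lemma exists_dist_lt_of_dist_lt {C C' : SolidBody d} {r : ℝ} (h : dist C C' < r)
    {x : EuclideanSpace ℝ (Fin d)} (hx : x ∈ C.points) : ∃ y ∈ C'.points, dist x y < r := by
  have h' : Metric.hausdorffDist C.points C'.points < r := h
  exact Metric.exists_dist_lt_of_hausdorffDist_lt hx h' ConvexBody.hausdorffEDist_ne_top

/-- A point around which `C` contains a ball of radius `r` lies in every body at Hausdorff distance
less than `r` from `C`. -/
lemma mem_of_ball_subset_of_dist_lt {C C' : SolidBody d} {x : EuclideanSpace ℝ (Fin d)} {r : ℝ}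
    (hx : Metric.ball x r ⊆ C.points) (h : dist C C' < r) : x ∈ C'.points := by
  by_contra hxC'
  obtain ⟨f, u, hfx, hfu⟩ :=
    geometric_hahn_banach_point_closed C'.convex_points C'.isClosed_points hxC'
  set a := (InnerProductSpace.toDual ℝ (EuclideanSpace ℝ (Fin d))).symm f with ha
  have hf (z) : f z = inner ℝ a z := by simp [ha]
  obtain ⟨z₀, hz₀⟩ := C'.1.nonempty
  have ha0 : 0 < ‖a‖ := by
    rw [norm_pos_iff]
    intro h0
    have h1 := hfu z₀ hz₀
    rw [hf, h0] at hfx h1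
    simp only [inner_zero_left] at hfx h1
    linarith
  obtain ⟨s, hs, hsr⟩ := exists_between h
  have hs0 : 0 < s := dist_nonneg.trans_lt hs
  -- Moving `x` by `s` against `a` lowers `f` by `s * ‖a‖`; a point of `C'` within `s` of the result
  -- would still have `f` below `f x`, on the wrong side of the hyperplane.
  have hy : x - (s / ‖a‖) • a ∈ Metric.ball x r := by
    rw [Metric.mem_ball, dist_eq_norm, sub_sub_cancel_left, norm_neg, norm_smul, Real.norm_eq_abs,
      abs_of_pos (by positivity), div_mul_cancel₀ _ ha0.ne']
    exact hsr
  obtain ⟨z, hz, hyz⟩ := exists_dist_lt_of_dist_lt hs (hx hy)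
  have h1 := hfu z hz
  have h2 : f z - f (x - (s / ‖a‖) • a) ≤ ‖a‖ * dist (x - (s / ‖a‖) • a) z := by
    rw [← map_sub, hf, dist_comm, dist_eq_norm]
    exact real_inner_le_norm _ _
  have h3 : f (x - (s / ‖a‖) • a) = f x - s * ‖a‖ := by
    rw [map_sub, map_smul, hf a, real_inner_self_eq_norm_sq, smul_eq_mul]
    field_simp
  have h4 := mul_lt_mul_of_pos_left hyz ha0
  linarith

lemma isOpen_setOf_mem_interior :
    IsOpen {q : SolidBody d × EuclideanSpace ℝ (Fin d) | q.2 ∈ interior q.1.points} := by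
  rw [Metric.isOpen_iff]
  rintro ⟨C, x⟩ hx
  obtain ⟨r, hr, hxr⟩ := Metric.isOpen_iff.1 isOpen_interior x hx
  refine ⟨r / 3, by positivity, ?_⟩
  rintro ⟨C', x'⟩ h
  rw [Metric.mem_ball, Prod.dist_eq, max_lt_iff] at h
  obtain ⟨hC, hx'⟩ := h
  refine mem_interior.2 ⟨Metric.ball x' (r / 3), fun z hz => ?_, Metric.isOpen_ball,
    Metric.mem_ball_self (by positivity)⟩
  refine mem_of_ball_subset_of_dist_lt (C := C) (r := r / 3) (fun w hw => ?_)
    (by rw [dist_comm]; exact hC)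
  refine interior_subset (hxr ?_)
  rw [Metric.mem_ball] at hz hw ⊢
  have := dist_triangle4 w z x' x
  simp only at hx'
  linarith

lemma isClosed_setOf_mem :
    IsClosed {q : SolidBody d × EuclideanSpace ℝ (Fin d) | q.2 ∈ q.1.points} := by
  rw [← isOpen_compl_iff, Metric.isOpen_iff]
  rintro ⟨C, x⟩ hx
  obtain ⟨r, hr, hxr⟩ := Metric.isOpen_iff.1 C.isClosed_points.isOpen_compl x hx
  refine ⟨r / 2, by positivity, ?_⟩
  rintro ⟨C', x'⟩ h hx'
  rw [Metric.mem_ball, Prod.dist_eq, max_lt_iff] at h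
  obtain ⟨y, hy, hyx⟩ := exists_dist_lt_of_dist_lt h.1 hx'
  refine hxr (a := y) ?_ hy
  rw [Metric.mem_ball]
  have := dist_triangle y x' x
  have := h.2
  simp only at hyx this
  rw [dist_comm] at hyx
  linarith

/-! ### Integrals and averages over bodies -/

/-- The integral over a convex body of a jointly continuous function depends continuously on the
body. -/
lemma continuous_setIntegral {V : Type*} [NormedAddCommGroup V] [NormedSpace ℝ V]
    {F : SolidBody d → EuclideanSpace ℝ (Fin d) → V} (hF : Continuous (Function.uncurry F)) :
    Continuous fun C : SolidBody d => ∫ x in C.points, F C x := by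
  have hFC (C : SolidBody d) : Continuous (F C) :=
    hF.comp (Continuous.prodMk_right C)
  have heq : (fun C : SolidBody d => ∫ x in C.points, F C x) =
      fun C => ∫ x, C.points.indicator (F C) x := by
    funext C
    rw [integral_indicator C.measurableSet_points]
  rw [heq, continuous_iff_continuousAt]
  intro C
  set K := Metric.cthickening 1 C.points
  have hK : IsCompact K := C.isCompact_points.cthickening
  obtain ⟨M, hM⟩ := hK.exists_bound_of_continuousOn (hFC C).continuousOn
  have hsub : ∀ᶠ C' in 𝓝 C, C'.points ⊆ K := by
    filter_upwards [Metric.ball_mem_nhds C one_pos] with C' hC' x hx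
    obtain ⟨y, hy, hxy⟩ := exists_dist_lt_of_dist_lt hC' hx
    exact Metric.mem_cthickening_of_dist_le x y 1 _ hy hxy.le
  have hbd : ∀ᶠ C' in 𝓝 C, ∀ x ∈ K, ‖F C' x‖ < M + 1 := by
    refine hK.eventually_forall_of_forall_eventually fun x hx => ?_
    have : ContinuousAt (fun q : SolidBody d × EuclideanSpace ℝ (Fin d) => ‖F q.1 q.2‖) (C, x) :=
      hF.norm.continuousAt
    exact this.eventually (gt_mem_nhds (by simpa using (hM x hx).trans_lt (lt_add_one M)))
  refine continuousAt_of_dominated (bound := K.indicator fun _ => M + 1) ?_ ?_ ?_ ?_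
  · exact Eventually.of_forall fun C' =>
      (hFC C').aestronglyMeasurable.indicator C'.measurableSet_points
  · filter_upwards [hsub, hbd] with C' h1 h2
    refine Eventually.of_forall fun x => ?_
    by_cases hx : x ∈ C'.points
    · rw [indicator_of_mem hx, indicator_of_mem (h1 hx)]
      exact (h2 x (h1 hx)).le
    · rw [indicator_of_notMem hx, norm_zero]
      refine indicator_nonneg (fun y hy => ?_) x
      exact (norm_nonneg _).trans (h2 y hy).le
  · rw [integrable_indicator_iff hK.measurableSet]
    exact integrableOn_const hK.measure_lt_top.ne
  -- The frontier of a convex set is null. Off it, membership of `x` is locally constant in the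
  -- body, so the indicators converge and dominated convergence applies.
  · have hfr : ∀ᵐ x : EuclideanSpace ℝ (Fin d), x ∉ frontier C.points := by
      rw [ae_iff]
      simpa using C.convex_points.addHaar_frontier volume
    filter_upwards [hfr] with x hx
    by_cases hxC : x ∈ C.points
    · have hxi : x ∈ interior C.points := by
        rw [C.isClosed_points.frontier_eq] at hx
        by_contra h
        exact hx ⟨hxC, h⟩
      have h1 : ∀ᶠ C' in 𝓝 C, x ∈ interior C'.points :=
        (Continuous.prodMk_left x).continuousAt.eventually
          (isOpen_setOf_mem_interior.mem_nhds (show (C, x) ∈ _ from hxi))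
      have h2 : ContinuousAt (fun C' => F C' x) C :=
        (hF.comp (Continuous.prodMk_left x)).continuousAt
      refine h2.congr ?_
      filter_upwards [h1] with C' h
      rw [indicator_of_mem (interior_subset h)]
    · have h1 : ∀ᶠ C' in 𝓝 C, x ∉ C'.points :=
        (Continuous.prodMk_left x).continuousAt.eventually
          (isClosed_setOf_mem.isOpen_compl.mem_nhds (show (C, x) ∈ _ from hxC))
      refine (continuousAt_const (y := (0 : V))).congr ?_
      filter_upwards [h1] with C' h
      rw [indicator_of_notMem h]

lemma volume_points_ne_zero (C : SolidBody d) : volume C.points ≠ 0 :=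
  (Measure.measure_pos_of_nonempty_interior volume C.2).ne'

lemma volume_points_ne_top (C : SolidBody d) : volume C.points ≠ ⊤ :=
  C.isCompact_points.measure_lt_top.ne

lemma continuous_setAverage {V : Type*} [NormedAddCommGroup V] [NormedSpace ℝ V]
    {F : SolidBody d → EuclideanSpace ℝ (Fin d) → V} (hF : Continuous (Function.uncurry F)) :
    Continuous fun C : SolidBody d => ⨍ x in C.points, F C x := by
  simp_rw [setAverage_eq]
  have h1 : Continuous fun C : SolidBody d => volume.real C.points := by
    have := continuous_setIntegral (d := d) (F := fun _ _ => (1 : ℝ)) continuous_const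
    simpa using this
  refine (h1.inv₀ fun C => ?_).smul (continuous_setIntegral hF)
  exact (ENNReal.toReal_pos C.volume_points_ne_zero C.volume_points_ne_top).ne'

/-- Integrals over the affine image of a convex body. -/
lemma setIntegral_image {V : Type*} [NormedAddCommGroup V] [NormedSpace ℝ V]
    (T : EuclideanSpace ℝ (Fin d) ≃ᵃ[ℝ] EuclideanSpace ℝ (Fin d)) (C : SolidBody d)
    (f : EuclideanSpace ℝ (Fin d) → V) :
    ∫ x in (C.image T).points, f x =
      |LinearMap.det (T.linear : EuclideanSpace ℝ (Fin d) →ₗ[ℝ] EuclideanSpace ℝ (Fin d))| •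
        ∫ x in C.points, f (T x) := by
  have hpts : (C.image T).points = T '' C.points := rfl
  set L : EuclideanSpace ℝ (Fin d) →L[ℝ] EuclideanSpace ℝ (Fin d) :=
    LinearMap.toContinuousLinearMap (T.linear : EuclideanSpace ℝ (Fin d) →ₗ[ℝ] _) with hL
  have hT (x) (_ : x ∈ C.points) : HasFDerivWithinAt T L C.points x := by
    have h : (T : EuclideanSpace ℝ (Fin d) → _) = fun x => L x + T 0 := by
      funext x
      simpa [hL] using T.map_vadd 0 x
    rw [h]
    exact (L.hasFDerivAt.add_const _).hasFDerivWithinAt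
  rw [hpts, integral_image_eq_integral_abs_det_fderiv_smul volume C.measurableSet_points hT
    T.injective.injOn, integral_smul]
  rfl

/-- Averages over the affine image of a convex body. -/
lemma setAverage_image {V : Type*} [NormedAddCommGroup V] [NormedSpace ℝ V]
    (T : EuclideanSpace ℝ (Fin d) ≃ᵃ[ℝ] EuclideanSpace ℝ (Fin d)) (C : SolidBody d)
    (f : EuclideanSpace ℝ (Fin d) → V) :
    ⨍ x in (C.image T).points, f x = ⨍ x in C.points, f (T x) := by
  have hdet : |LinearMap.det
      (T.linear : EuclideanSpace ℝ (Fin d) →ₗ[ℝ] EuclideanSpace ℝ (Fin d))| ≠ 0 := by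
    rw [abs_ne_zero]
    exact (LinearEquiv.isUnit_det' T.linear).ne_zero
  have hvol := setIntegral_image T C (fun _ => (1 : ℝ))
  simp only [integral_const, measureReal_restrict_apply_univ, smul_eq_mul, mul_one] at hvol
  rw [setAverage_eq, setAverage_eq, setIntegral_image, hvol, smul_smul, mul_inv, mul_right_comm,
    inv_mul_cancel₀ hdet, one_mul]

lemma integrableOn_points {V : Type*} [NormedAddCommGroup V] {f : EuclideanSpace ℝ (Fin d) → V}
    (hf : Continuous f) (C : SolidBody d) : IntegrableOn f C.points :=
  hf.continuousOn.integrableOn_compact C.isCompact_points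

lemma setAverage_const_eq {V : Type*} [NormedAddCommGroup V] [NormedSpace ℝ V] [CompleteSpace V]
    (C : SolidBody d) (c : V) : ⨍ _ in C.points, c = c :=
  setAverage_const C.volume_points_ne_zero C.volume_points_ne_top c

lemma setAverage_add {V : Type*} [NormedAddCommGroup V] [NormedSpace ℝ V]
    {f g : EuclideanSpace ℝ (Fin d) → V} (hf : Continuous f) (hg : Continuous g)
    (C : SolidBody d) :
    ⨍ x in C.points, (f x + g x) = (⨍ x in C.points, f x) + ⨍ x in C.points, g x := by
  rw [setAverage_eq, setAverage_eq, setAverage_eq,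
    integral_add (integrableOn_points hf C) (integrableOn_points hg C), smul_add]

lemma setAverage_clm {V W : Type*} [NormedAddCommGroup V] [NormedSpace ℝ V] [CompleteSpace V]
    [NormedAddCommGroup W] [NormedSpace ℝ W] [CompleteSpace W]
    {f : EuclideanSpace ℝ (Fin d) → V} (hf : Continuous f) (L : V →L[ℝ] W) (C : SolidBody d) :
    ⨍ x in C.points, L (f x) = L (⨍ x in C.points, f x) := by
  rw [setAverage_eq, setAverage_eq, L.integral_comp_comm (integrableOn_points hf C), map_smul]

/-! ### Centroid and the gauge around it -/

/-- The centroid of a convex body. -/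
noncomputable def centroid (C : SolidBody d) : EuclideanSpace ℝ (Fin d) :=
  ⨍ x in C.points, x

lemma centroid_mem_interior (C : SolidBody d) : centroid C ∈ interior C.points := by
  have : Fact (volume C.points < ⊤) := ⟨C.volume_points_ne_top.lt_top⟩
  obtain ⟨x, hx⟩ : (interior C.points).Nonempty := C.2
  obtain ⟨r, hr, hxr⟩ := Metric.nhds_basis_closedBall.mem_iff.1 (isOpen_interior.mem_nhds hx)
  have hB : Metric.closedBall x r ⊆ C.points := hxr.trans interior_subset
  have hres : (volume.restrict C.points).restrict (Metric.closedBall x r) =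
      volume.restrict (Metric.closedBall x r) := by
    rw [Measure.restrict_restrict measurableSet_closedBall, inter_eq_left.2 hB]
  have h0 : volume (Metric.closedBall x r) ≠ 0 := (Metric.measure_closedBall_pos _ _ hr).ne'
  refine C.convex_points.average_mem_interior_of_set (t := Metric.closedBall x r) ?_
    (ae_restrict_mem C.measurableSet_points) (integrableOn_points continuous_id C) ?_
  · rwa [Measure.restrict_apply measurableSet_closedBall, inter_eq_left.2 hB]
  · rw [hres]
    refine hxr ((convex_closedBall x r).set_average_mem Metric.isClosed_closedBall h0
      measure_closedBall_lt_top.ne (ae_restrict_mem measurableSet_closedBall) ?_)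
    exact continuous_id.continuousOn.integrableOn_compact (isCompact_closedBall x r)

lemma continuous_centroid : Continuous (centroid (d := d)) :=
  continuous_setAverage (F := fun _ x => x) continuous_snd

lemma centroid_image (T : EuclideanSpace ℝ (Fin d) ≃ᵃ[ℝ] EuclideanSpace ℝ (Fin d))
    (C : SolidBody d) : centroid (C.image T) = T (centroid C) := by
  have h (x) : T x = LinearMap.toContinuousLinearMap
      (T.linear : EuclideanSpace ℝ (Fin d) →ₗ[ℝ] EuclideanSpace ℝ (Fin d)) x + T 0 := by
    simpa using T.map_vadd 0 x
  rw [h (centroid C), centroid, setAverage_image,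
    setAverage_congr_fun C.measurableSet_points (Eventually.of_forall fun x _ => h x),
    setAverage_add (ContinuousLinearMap.continuous _) continuous_const, setAverage_const_eq,
    setAverage_clm (f := fun x => x) continuous_id, centroid]

/-- The translate of a convex body with its centroid at the origin. -/
def centered (C : SolidBody d) : Set (EuclideanSpace ℝ (Fin d)) :=
  (fun u => centroid C + u) ⁻¹' C.points

lemma convex_centered (C : SolidBody d) : Convex ℝ C.centered :=
  C.convex_points.translate_preimage_right (centroid C)

lemma interior_centered (C : SolidBody d) :
    interior C.centered = (fun u => centroid C + u) ⁻¹' interior C.points :=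
  ((Homeomorph.addLeft (centroid C)).preimage_interior C.points).symm

lemma isClosed_centered (C : SolidBody d) : IsClosed C.centered :=
  C.isClosed_points.preimage (by fun_prop)

lemma centered_mem_nhds (C : SolidBody d) : C.centered ∈ 𝓝 0 := by
  rw [← mem_interior_iff_mem_nhds, interior_centered]
  simpa using C.centroid_mem_interior

lemma isBounded_centered (C : SolidBody d) : Bornology.IsBounded C.centered := by
  have : C.centered = (Homeomorph.addLeft (centroid C)) ⁻¹' C.points := rfl
  rw [this]
  exact ((Homeomorph.isCompact_preimage _).2 C.isCompact_points).isBounded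

/-- The gauge of a convex body relative to its centroid. -/
noncomputable def centralGauge (C : SolidBody d) (u : EuclideanSpace ℝ (Fin d)) : ℝ :=
  gauge C.centered u

lemma centralGauge_nonneg (C : SolidBody d) (u : EuclideanSpace ℝ (Fin d)) :
    0 ≤ C.centralGauge u := gauge_nonneg u

lemma centralGauge_smul {r : ℝ} (hr : 0 ≤ r) (C : SolidBody d) (u : EuclideanSpace ℝ (Fin d)) :
    C.centralGauge (r • u) = r * C.centralGauge u := by
  rw [centralGauge, gauge_smul_of_nonneg hr, smul_eq_mul, centralGauge]

lemma centralGauge_pos (C : SolidBody d) {u : EuclideanSpace ℝ (Fin d)} (hu : u ≠ 0) :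
    0 < C.centralGauge u :=
  (gauge_pos (absorbent_nhds_zero C.centered_mem_nhds)
    (NormedSpace.isVonNBounded_of_isBounded ℝ C.isBounded_centered)).2 hu

lemma centralGauge_le_one (C : SolidBody d) (u : EuclideanSpace ℝ (Fin d)) :
    C.centralGauge u ≤ 1 ↔ centroid C + u ∈ C.points := by
  rw [centralGauge, gauge_le_one_iff_mem_closure C.convex_centered C.centered_mem_nhds,
    C.isClosed_centered.closure_eq]
  rfl

lemma centralGauge_lt_one (C : SolidBody d) (u : EuclideanSpace ℝ (Fin d)) :
    C.centralGauge u < 1 ↔ centroid C + u ∈ interior C.points := by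
  rw [centralGauge, gauge_lt_one_iff_mem_interior C.convex_centered C.centered_mem_nhds,
    interior_centered]
  rfl

lemma centralGauge_le {a : ℝ} (ha : 0 < a) (C : SolidBody d) (u : EuclideanSpace ℝ (Fin d)) :
    C.centralGauge u ≤ a ↔ centroid C + a⁻¹ • u ∈ C.points := by
  rw [← centralGauge_le_one, centralGauge_smul (by positivity), inv_mul_le_iff₀ ha, mul_one]

lemma centralGauge_lt {a : ℝ} (ha : 0 < a) (C : SolidBody d) (u : EuclideanSpace ℝ (Fin d)) :
    C.centralGauge u < a ↔ centroid C + a⁻¹ • u ∈ interior C.points := by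
  rw [← centralGauge_lt_one, centralGauge_smul (by positivity), inv_mul_lt_iff₀ ha, mul_one]

/-- For `a > 0`, gauge `≤ a` is membership, and gauge `< a` interior membership, of a point
depending continuously on the pair. Joint closedness and openness of these relations give the two
semicontinuities. -/
lemma continuous_centralGauge :
    Continuous fun q : SolidBody d × EuclideanSpace ℝ (Fin d) => q.1.centralGauge q.2 := by
  have hmap (a : ℝ) : Continuous fun q : SolidBody d × EuclideanSpace ℝ (Fin d) =>
      (q.1, centroid q.1 + a⁻¹ • q.2) :=
    continuous_fst.prodMk ((continuous_centroid.comp continuous_fst).add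
      (by fun_prop))
  rw [continuous_iff_lower_upperSemicontinuous]
  constructor
  · rw [lowerSemicontinuous_iff_isClosed_preimage]
    intro a
    have hpos {a : ℝ} (ha : 0 < a) : IsClosed
        ((fun q : SolidBody d × EuclideanSpace ℝ (Fin d) => q.1.centralGauge q.2) ⁻¹' Iic a) := by
      convert isClosed_setOf_mem.preimage (hmap a) using 1
      ext q
      exact centralGauge_le ha q.1 q.2
    rcases lt_trichotomy a 0 with ha | rfl | ha
    · convert isClosed_empty using 1
      ext q
      simpa using ha.trans_le (q.1.centralGauge_nonneg q.2)
    · have : Iic (0 : ℝ) = ⋂ b : Ioi (0 : ℝ), Iic b.1 := by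
        ext t
        simp only [mem_Iic, mem_iInter, Subtype.forall, mem_Ioi]
        exact ⟨fun h b hb => h.trans hb.le, fun h => le_of_forall_pos_le_add (by simpa using h)⟩
      rw [this, preimage_iInter]
      exact isClosed_iInter fun b => hpos b.2
    · exact hpos ha
  · rw [upperSemicontinuous_iff_isOpen_preimage]
    intro a
    rcases le_or_gt a 0 with ha | ha
    · convert isOpen_empty using 1
      ext q
      simpa using ha.trans (q.1.centralGauge_nonneg q.2)
    · convert isOpen_setOf_mem_interior.preimage (hmap a) using 1
      ext q
      exact centralGauge_lt ha q.1 q.2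

lemma centralGauge_image (T : EuclideanSpace ℝ (Fin d) ≃ᵃ[ℝ] EuclideanSpace ℝ (Fin d))
    (C : SolidBody d) (u : EuclideanSpace ℝ (Fin d)) :
    (C.image T).centralGauge (T.linear u) = C.centralGauge u := by
  have hmem (w : EuclideanSpace ℝ (Fin d)) :
      T.linear w ∈ (C.image T).centered ↔ w ∈ C.centered := by
    have h1 : centroid (C.image T) + T.linear w = T (centroid C + w) := by
      rw [centroid_image, add_comm, add_comm (centroid C)]
      exact (T.map_vadd (centroid C) w).symm
    change centroid (C.image T) + T.linear w ∈ T '' C.points ↔ _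
    rw [h1, T.injective.mem_set_image]
    rfl
  simp only [centralGauge, gauge_def', ← map_smul, hmem]

/-! ### Skew vector and the two affine points -/

/-- An affinely covariant vector: the average of `x - g` over the body, where `g` is the centroid,
weighted by the excess over `m` of the gauge of the reflected vector `g - x`. -/
noncomputable def skewVector (m : ℝ) (C : SolidBody d) : EuclideanSpace ℝ (Fin d) :=
  ⨍ x in C.points, max (C.centralGauge (centroid C - x) - m) 0 • (x - centroid C)

lemma continuous_skewVector_integrand (m : ℝ) :
    Continuous fun q : SolidBody d × EuclideanSpace ℝ (Fin d) =>
      max (q.1.centralGauge (centroid q.1 - q.2) - m) 0 • (q.2 - centroid q.1) := by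
  have h := continuous_centroid.comp (continuous_fst (X := SolidBody d)
    (Y := EuclideanSpace ℝ (Fin d)))
  have h1 : Continuous fun q : SolidBody d × EuclideanSpace ℝ (Fin d) =>
      q.1.centralGauge (centroid q.1 - q.2) :=
    continuous_centralGauge.comp (continuous_fst.prodMk (h.sub continuous_snd))
  exact ((h1.sub continuous_const).max continuous_const).smul (continuous_snd.sub h)

lemma continuous_skewVector_integrand_right (m : ℝ) (C : SolidBody d) :
    Continuous fun x => max (C.centralGauge (centroid C - x) - m) 0 • (x - centroid C) := by
  have h : Continuous C.centralGauge := continuous_gauge C.convex_centered C.centered_mem_nhds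
  fun_prop

lemma continuous_skewVector (m : ℝ) : Continuous (skewVector (d := d) m) :=
  continuous_setAverage (continuous_skewVector_integrand m)

lemma skewVector_image (m : ℝ) (T : EuclideanSpace ℝ (Fin d) ≃ᵃ[ℝ] EuclideanSpace ℝ (Fin d))
    (C : SolidBody d) : skewVector m (C.image T) = T.linear (skewVector m C) := by
  have h (x y) : T x - T y = T.linear (x - y) := (T.toAffineMap.linearMap_vsub x y).symm
  rw [skewVector, setAverage_image]
  simp_rw [centroid_image, h, centralGauge_image, ← map_smul]
  exact setAverage_clm (continuous_skewVector_integrand_right m C)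
    (LinearMap.toContinuousLinearMap
      (T.linear : EuclideanSpace ℝ (Fin d) →ₗ[ℝ] EuclideanSpace ℝ (Fin d))) C

/-- The point `g + s v / max (gauge (s v)) δ`, where `g` is the centroid and `v` the skew vector:
as soon as `δ ≤ gauge (s v)`, the ray from `g` in direction `s v` leaves the body there. -/
noncomputable def rayPoint (m δ s : ℝ) (C : SolidBody d) : EuclideanSpace ℝ (Fin d) :=
  centroid C + (max (C.centralGauge (s • skewVector m C)) δ)⁻¹ • s • skewVector m C

lemma isAffinePoint_rayPoint (m s : ℝ) {δ : ℝ} (hδ : 0 < δ) :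
    IsAffinePoint (rayPoint (d := d) m δ s) where
  continuous := by
    have hv : Continuous fun C : SolidBody d => s • skewVector m C := by
      have := continuous_skewVector (d := d) m
      fun_prop
    have hmax : Continuous fun C : SolidBody d => max (C.centralGauge (s • skewVector m C)) δ :=
      (continuous_centralGauge.comp (continuous_id.prodMk hv)).max continuous_const
    have hinv := hmax.inv₀ fun C => (lt_max_of_lt_right hδ).ne'
    exact continuous_centroid.add (hinv.smul hv)
  equivariant T C := by
    rw [rayPoint, skewVector_image, centroid_image, ← map_smul, centralGauge_image, ← map_smul,
      rayPoint, add_comm, add_comm (centroid C)]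
    exact (T.map_vadd _ _).symm

lemma rayPoint_mem (m s : ℝ) {δ : ℝ} (hδ : 0 < δ) (C : SolidBody d) :
    rayPoint m δ s C ∈ C.points := by
  rw [rayPoint, ← centralGauge_le (lt_max_of_lt_right hδ)]
  exact le_max_left _ _

/-- If `δ` does not exceed the gauges of `±v`, where `v ≠ 0` is the skew vector, then the points
`rayPoint m δ (±1) C` are the end points of a chord of `C`. -/
lemma line_inter_points_eq_segment {m δ : ℝ} {C : SolidBody d} (hv : skewVector m C ≠ 0)
    (h₁ : δ ≤ C.centralGauge (skewVector m C)) (h₂ : δ ≤ C.centralGauge (-skewVector m C)) :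
    rayPoint m δ 1 C ≠ rayPoint m δ (-1) C ∧
    (affineSpan ℝ {rayPoint m δ 1 C, rayPoint m δ (-1) C} : Set (EuclideanSpace ℝ (Fin d))) ∩
      C.points = segment ℝ (rayPoint m δ 1 C) (rayPoint m δ (-1) C) := by
  set v := skewVector m C with hv_def
  have ha := C.centralGauge_pos hv
  have hb := C.centralGauge_pos (neg_ne_zero.2 hv)
  set a := C.centralGauge v with ha_def
  set b := C.centralGauge (-v) with hb_def
  have hp₁ : rayPoint m δ 1 C = centroid C + a⁻¹ • v := by
    rw [rayPoint, one_smul, ← hv_def, ← ha_def, max_eq_left h₁]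
  have hp₂ : rayPoint m δ (-1) C = centroid C + b⁻¹ • -v := by
    rw [rayPoint, neg_one_smul, ← hv_def, ← hb_def, max_eq_left h₂]
  have hmem₁ : rayPoint m δ 1 C ∈ C.points := by
    rw [hp₁, ← centralGauge_le ha]
  have hmem₂ : rayPoint m δ (-1) C ∈ C.points := by
    rw [hp₂, ← centralGauge_le hb]
  have ha' := inv_pos.2 ha
  have hb' := inv_pos.2 hb
  constructor
  · rw [hp₁, hp₂, Ne, add_right_inj, smul_neg, ← sub_eq_zero, sub_neg_eq_add, ← add_smul,
      smul_eq_zero, not_or]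
    exact ⟨by positivity, hv⟩
  · refine Subset.antisymm ?_ (subset_inter ?_ (C.convex_points.segment_subset hmem₁ hmem₂))
    · rintro x ⟨hx, hxC⟩
      obtain ⟨t, rfl⟩ := mem_affineSpan_pair_iff_exists_lineMap_eq.1 hx
      have hline : AffineMap.lineMap (rayPoint m δ 1 C) (rayPoint m δ (-1) C) t =
          centroid C + (a⁻¹ - t * (a⁻¹ + b⁻¹)) • v := by
        rw [hp₁, hp₂, AffineMap.lineMap_apply_module]
        module
      rw [hline, ← centralGauge_le_one] at hxC
      rw [segment_eq_image_lineMap]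
      refine ⟨t, ?_, rfl⟩
      -- The body meets the line exactly for `-b⁻¹ ≤ r ≤ a⁻¹`, and these bounds correspond to `t =
      -- 1` and `t = 0`.
      set r := a⁻¹ - t * (a⁻¹ + b⁻¹) with hr
      rcases le_total 0 r with h0 | h0
      · rw [centralGauge_smul h0, ← ha_def, ← le_div_iff₀ ha, one_div] at hxC
        constructor
        · by_contra! ht
          nlinarith
        · by_contra! ht
          nlinarith
      · rw [show r • v = (-r) • -v by module, centralGauge_smul (neg_nonneg.2 h0), ← hb_def,
          ← le_div_iff₀ hb, one_div] at hxC
        constructor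
        · by_contra! ht
          nlinarith
        · by_contra! ht
          nlinarith
    · rw [segment_eq_image_lineMap]
      rintro _ ⟨t, -, rfl⟩
      exact AffineMap.lineMap_mem_affineSpan_pair t _ _

lemma symmetryMeasure_eq_zero_of_inter_eq_segment
    {p₁ p₂ : SolidBody d → EuclideanSpace ℝ (Fin d)} {C : SolidBody d} (hne : p₁ C ≠ p₂ C)
    (h : (affineSpan ℝ {p₁ C, p₂ C} : Set (EuclideanSpace ℝ (Fin d))) ∩ C.points =
      segment ℝ (p₁ C) (p₂ C)) : symmetryMeasure p₁ p₂ C = 0 := by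
  rw [symmetryMeasure, asymmetry, if_neg hne, h, hausdorffMeasure_segment, edist_dist,
    ENNReal.toReal_ofReal dist_nonneg, dist_eq_norm, div_self, sub_self]
  exact norm_ne_zero_iff.2 (sub_ne_zero.2 hne)

/-! ### The cube with a corner cut off -/

/-- The cube `[0, b]ᵈ`. -/
def cube (d : ℕ) (b : ℝ) : Set (EuclideanSpace ℝ (Fin d)) := {x | ∀ i, x i ∈ Icc 0 b}

lemma isCompact_cube (b : ℝ) : IsCompact (cube d b) := by
  have : cube d b = (EuclideanSpace.equiv (Fin d) ℝ).toHomeomorph ⁻¹' (Icc 0 fun _ => b) := by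
    ext x
    simp [cube, Pi.le_def, forall_and]
  rw [this]
  exact (Homeomorph.isCompact_preimage _).2 isCompact_Icc

lemma volume_cube {b : ℝ} (hb : 0 ≤ b) : volume.real (cube d b) = b ^ d := by
  have h : cube d b = WithLp.ofLp ⁻¹' (Icc 0 fun _ => b) := by
    ext x
    simp [cube, Pi.le_def, forall_and]
  rw [measureReal_def, h, (PiLp.volume_preserving_ofLp (Fin d)).measure_preimage
    measurableSet_Icc.nullMeasurableSet, Real.volume_Icc_pi_toReal (show (0 : Fin d → ℝ) ≤ fun _ => b from fun _ => hb)]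
  simp

lemma setIntegral_cube_sub_half (i : Fin d) : ∫ x in cube d 1, (x i - 1 / 2) = 0 := by
  rw [← integral_indicator (isCompact_cube 1).measurableSet]
  set f := (cube d 1).indicator fun x : EuclideanSpace ℝ (Fin d) => x i - 1 / 2 with hf
  have h1 := integral_sub_left_eq_self f volume (WithLp.toLp 2 fun _ => (1 : ℝ))
  -- Reflection in the centre of the cube changes the sign of the integrand.
  have h2 (x) : f (WithLp.toLp 2 (fun _ => (1 : ℝ)) - x) = -f x := by
    have hmem : WithLp.toLp 2 (fun _ => (1 : ℝ)) - x ∈ cube d 1 ↔ x ∈ cube d 1 := by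
      refine forall_congr' fun j => ?_
      simp only [PiLp.sub_apply, mem_Icc]
      constructor <;> rintro ⟨h1, h2⟩ <;> constructor <;> linarith
    by_cases hx : x ∈ cube d 1
    · rw [hf, indicator_of_mem hx, indicator_of_mem (hmem.2 hx)]
      simp only [PiLp.sub_apply]
      ring
    · rw [hf, indicator_of_notMem hx, indicator_of_notMem (mt hmem.1 hx), neg_zero]
  simp_rw [h2, integral_neg] at h1
  linarith

/-- The sum of the coordinates. -/
noncomputable def coordSum (d : ℕ) : EuclideanSpace ℝ (Fin d) →L[ℝ] ℝ :=
  ∑ i, EuclideanSpace.proj i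

lemma coordSum_apply (x : EuclideanSpace ℝ (Fin d)) : coordSum d x = ∑ i, x i := by
  simp [coordSum]

lemma coordSum_const (t : ℝ) : coordSum d (WithLp.toLp 2 fun _ => t) = d * t := by
  simp [coordSum_apply]

/-- The unit cube with the corner `∑ xᵢ < ε` at the origin cut off. -/
def cutCubeSet (d : ℕ) (ε : ℝ) : Set (EuclideanSpace ℝ (Fin d)) :=
  cube d 1 ∩ {x | ε ≤ coordSum d x}

lemma mem_cutCubeSet {ε : ℝ} {x : EuclideanSpace ℝ (Fin d)} :
    x ∈ cutCubeSet d ε ↔ (∀ i, x i ∈ Icc (0 : ℝ) 1) ∧ ε ≤ coordSum d x := Iff.rfl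

lemma const_mem_interior_cutCubeSet {ε t : ℝ} (h0 : 0 < t) (h1 : t < 1) (h : ε < d * t) :
    (WithLp.toLp 2 fun _ => t) ∈ interior (cutCubeSet d ε) := by
  have hsub : (⋂ i, {x : EuclideanSpace ℝ (Fin d) | x i ∈ Ioo 0 1}) ∩ {x | ε < coordSum d x} ⊆
      cutCubeSet d ε := by
    rintro x ⟨hx, hx'⟩
    rw [mem_iInter] at hx
    exact ⟨fun i => Ioo_subset_Icc_self (hx i), le_of_lt (show ε < coordSum d x from hx')⟩
  refine interior_maximal hsub (IsOpen.inter ?_ ?_) ⟨?_, ?_⟩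
  · exact isOpen_iInter_of_finite fun i => isOpen_Ioo.preimage (EuclideanSpace.proj i).continuous
  · exact isOpen_lt continuous_const (coordSum d).continuous
  · exact mem_iInter.2 fun i => ⟨h0, h1⟩
  · change ε < coordSum d _
    rwa [coordSum_const]

/-- The unit cube with a corner cut off, as a convex body. -/
def cutCube (d : ℕ) (ε : ℝ) (h : ε < d * (1 / 2)) : SolidBody d :=
  have hne := const_mem_interior_cutCubeSet (d := d) (by norm_num) (by norm_num) h
  ⟨{ carrier := cutCubeSet d ε
     convex' := by
      refine Convex.inter (fun x hx y hy a b ha hb hab i => ?_)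
        (convex_halfSpace_ge (coordSum d).isLinear ε)
      exact convex_Icc (0 : ℝ) 1 (hx i) (hy i) ha hb hab
     isCompact' := (isCompact_cube 1).inter_right
      (isClosed_le continuous_const (coordSum d).continuous)
     nonempty' := ⟨_, interior_subset hne⟩ }, ⟨_, hne⟩⟩

lemma points_cutCube {ε : ℝ} (h : ε < d * (1 / 2)) : (cutCube d ε h).points = cutCubeSet d ε := rfl

section cutCube

variable {ε : ℝ} (h : ε < d * (1 / 2))

lemma centroid_cutCube_apply (i : Fin d) :
    (centroid (cutCube d ε h)) i =
      (volume.real (cutCubeSet d ε))⁻¹ * ∫ x in cutCubeSet d ε, x i := by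
  have := setAverage_clm (f := fun x => x) continuous_id
    (EuclideanSpace.proj (𝕜 := ℝ) i : EuclideanSpace ℝ (Fin d) →L[ℝ] ℝ) (cutCube d ε h)
  rw [setAverage_eq, points_cutCube, smul_eq_mul] at this
  exact this.symm

lemma volume_cutCubeSet_pos (h : ε < d * (1 / 2)) : 0 < volume.real (cutCubeSet d ε) :=
  ENNReal.toReal_pos (cutCube d ε h).volume_points_ne_zero (cutCube d ε h).volume_points_ne_top

lemma cube_diff_cutCubeSet_subset : cube d 1 \ cutCubeSet d ε ⊆ cube d ε := by
  rintro x ⟨hx, hx'⟩ i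
  refine ⟨(hx i).1, ?_⟩
  have h1 : coordSum d x < ε := by
    by_contra! h1
    exact hx' ⟨hx, h1⟩
  rw [coordSum_apply] at h1
  exact (Finset.single_le_sum (f := fun i => x i) (fun j _ => (hx j).1)
    (Finset.mem_univ i)).trans h1.le

lemma measurableSet_cutCubeSet : MeasurableSet (cutCubeSet d ε) :=
  (isCompact_cube 1).measurableSet.inter
    (isClosed_le continuous_const (coordSum d).continuous).measurableSet

lemma volume_cutCubeSet_ge (hε : 0 ≤ ε) : 1 - ε ^ d ≤ volume.real (cutCubeSet d ε) := by
  have h1 : volume.real (cube d 1) ≤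
      volume.real (cutCubeSet d ε) + volume.real (cube d 1 \ cutCubeSet d ε) := by
    refine (measureReal_mono (s₂ := cutCubeSet d ε ∪ (cube d 1 \ cutCubeSet d ε)) ?_ ?_).trans
      (measureReal_union_le _ _)
    · rw [union_sdiff_self]
      exact subset_union_right
    · rw [union_sdiff_self, union_eq_right.2 (show cutCubeSet d ε ⊆ cube d 1 from inter_subset_left)]
      exact (isCompact_cube 1).measure_lt_top.ne
  have h2 : volume.real (cube d 1 \ cutCubeSet d ε) ≤ ε ^ d := by
    rw [← volume_cube hε]
    exact measureReal_mono cube_diff_cutCubeSet_subset (isCompact_cube ε).measure_lt_top.ne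
  rw [volume_cube zero_le_one, one_pow] at h1
  linarith

lemma integrableOn_cube {f : EuclideanSpace ℝ (Fin d) → ℝ} (hf : Continuous f) :
    IntegrableOn f (cube d 1) :=
  hf.continuousOn.integrableOn_compact (isCompact_cube 1)

/-- The discarded corner lies in `[0, ε]ᵈ`, where `x i ≤ 1 / 2`, so discarding it cannot lower the
mean of `x i`. -/
lemma half_le_centroid_cutCube (hε : ε ≤ 1 / 2) (i : Fin d) :
    1 / 2 ≤ (centroid (cutCube d ε h)) i := by
  have hc : Continuous fun x : EuclideanSpace ℝ (Fin d) => x i - 1 / 2 := by fun_prop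
  have h1 := setIntegral_sdiff (μ := volume) (measurableSet_cutCubeSet (d := d) (ε := ε))
    (integrableOn_cube hc) inter_subset_left
  have h2 : ∫ x in cube d 1 \ cutCubeSet d ε, (x i - 1 / 2) ≤ 0 := by
    refine setIntegral_nonpos ((isCompact_cube 1).measurableSet.diff measurableSet_cutCubeSet)
      fun x hx => ?_
    have := (cube_diff_cutCubeSet_subset hx i).2
    linarith
  have hi : IntegrableOn (fun x : EuclideanSpace ℝ (Fin d) => x i) (cutCubeSet d ε) :=
    (integrableOn_cube (by fun_prop)).mono_set inter_subset_left
  have h3 : ∫ x in cutCubeSet d ε, (x i - 1 / 2) =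
      (∫ x in cutCubeSet d ε, x i) - volume.real (cutCubeSet d ε) * (1 / 2) := by
    have hvol : volume (cutCubeSet d ε) ≠ ⊤ := (cutCube d ε h).volume_points_ne_top
    rw [integral_sub hi (integrableOn_const hvol), setIntegral_const, smul_eq_mul]
  rw [setIntegral_cube_sub_half] at h1
  rw [centroid_cutCube_apply, le_inv_mul_iff₀ (volume_cutCubeSet_pos h)]
  linarith

/-- The integral of `x i` is at most its value `1 / 2` over the full cube, while the volume is at
least `1 - ε ^ d`. -/
lemma centroid_cutCube_le (hε₀ : 0 ≤ ε) (hε : ε ^ d < 1) (i : Fin d) :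
    (centroid (cutCube d ε h)) i ≤ 1 / (2 * (1 - ε ^ d)) := by
  have hi : IntegrableOn (fun x : EuclideanSpace ℝ (Fin d) => x i) (cube d 1) :=
    integrableOn_cube (by fun_prop)
  have h1 : ∫ x in cutCubeSet d ε, x i ≤ ∫ x in cube d 1, x i := by
    refine setIntegral_mono_set hi ?_ (Eventually.of_forall inter_subset_left)
    filter_upwards [ae_restrict_mem (isCompact_cube 1).measurableSet] with x hx
    exact (hx i).1
  have h2 := setIntegral_cube_sub_half i
  rw [integral_sub hi (integrableOn_const (isCompact_cube 1).measure_lt_top.ne),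
    setIntegral_const, smul_eq_mul, volume_cube zero_le_one, one_pow] at h2
  have h3 := volume_cutCubeSet_ge (d := d) hε₀
  rw [centroid_cutCube_apply, inv_mul_le_iff₀ (volume_cutCubeSet_pos h), mul_one_div,
    le_div_iff₀ (by linarith)]
  have h4 : (∫ x in cutCubeSet d ε, x i) * (2 * (1 - ε ^ d)) ≤ 1 / 2 * (2 * (1 - ε ^ d)) :=
    mul_le_mul_of_nonneg_right (by linarith) (by linarith)
  linarith

end cutCube

/-! ### Nonvanishing of the skew vector -/

/-- For a suitable cut cube the skew vector has a positive sum of coordinates: the points whose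
reflection in the centroid has large gauge all lie on the side of the corner `(1, …, 1)`. -/
lemma skewVector_cutCube_ne_zero {C : SolidBody d} {ε q : ℝ} (h : ε < d * (1 / 2))
    (hC : C.points = cutCubeSet d ε) (hq₀ : 0 < q) (hq₁ : q ≤ 1)
    (hqε : d * (1 - q) < ε)
    (hlo : ∀ i, 1 / 2 ≤ (centroid C) i)
    (hhi : ∀ i, (centroid C) i * (1 + q) ≤ 1) :
    skewVector q⁻¹ C ≠ 0 := by
  set g := centroid C with hg
  have hmem (x : EuclideanSpace ℝ (Fin d)) : C.centralGauge (g - x) ≤ q⁻¹ ↔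
      (∀ i, (g + q • (g - x)) i ∈ Icc (0 : ℝ) 1) ∧ ε ≤ coordSum d (g + q • (g - x)) := by
    rw [centralGauge_le (inv_pos.2 hq₀), inv_inv, hC, mem_cutCubeSet]
  have hSlo : d * (1 / 2) ≤ coordSum d g := by
    rw [coordSum_apply]
    simpa using Finset.sum_le_sum fun i (_ : i ∈ Finset.univ) => hlo i
  have hShi : coordSum d g * (1 + q) ≤ d := by
    rw [coordSum_apply, Finset.sum_mul]
    simpa using Finset.sum_le_sum fun i (_ : i ∈ Finset.univ) => hhi i
  set F : EuclideanSpace ℝ (Fin d) → EuclideanSpace ℝ (Fin d) :=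
    fun x => max (C.centralGauge (g - x) - q⁻¹) 0 • (x - g) with hF
  have hFc : Continuous F := continuous_skewVector_integrand_right q⁻¹ C
  have hcoord (x) : coordSum d (F x) =
      max (C.centralGauge (g - x) - q⁻¹) 0 * (coordSum d x - coordSum d g) := by
    rw [hF, map_smul, map_sub, smul_eq_mul]
  have hnonneg : ∀ x ∈ C.points, 0 ≤ coordSum d (F x) := by
    intro x hx
    rw [hC, mem_cutCubeSet] at hx
    rw [hcoord]
    rcases le_total (coordSum d g) (coordSum d x) with hle | hle
    · exact mul_nonneg (le_max_right _ _) (sub_nonneg.2 hle)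
    -- On the side of the cut, `g + q • (g - x)` stays in the cube by the bounds on `g`, and its
    -- coordinate sum is at least that of `g`, hence above `ε`: the weight vanishes.
    · have : C.centralGauge (g - x) ≤ q⁻¹ := by
        rw [hmem]
        constructor
        · intro i
          obtain ⟨h0, h1⟩ := hx.1 i
          have := hlo i
          have := hhi i
          simp only [PiLp.add_apply, PiLp.smul_apply, PiLp.sub_apply, smul_eq_mul, mem_Icc]
          constructor
          · nlinarith
          · nlinarith
        · rw [map_add, map_smul, map_sub, smul_eq_mul]
          nlinarith
      rw [max_eq_right (sub_nonpos.2 this), zero_mul]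
  have hd : (0 : ℝ) < d := by
    rcases Nat.eq_zero_or_pos d with rfl | hd
    · norm_num at h hqε
      linarith
    · exact_mod_cast hd
  have hone : 0 < coordSum d (F (WithLp.toLp 2 fun _ => (1 : ℝ))) := by
    -- The scaled reflection of `(1, …, 1)` has coordinate sum at most `d * (1 - q) < ε`, so it
    -- falls into the removed corner.
    have h1 : q⁻¹ < C.centralGauge (g - WithLp.toLp 2 fun _ => (1 : ℝ)) := by
      rw [← not_le, hmem]
      rintro ⟨-, h2⟩
      rw [map_add, map_smul, map_sub, smul_eq_mul, coordSum_const] at h2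
      linarith
    rw [hcoord, coordSum_const]
    have h2 : 0 < (d : ℝ) * 1 - coordSum d g := by nlinarith
    exact mul_pos (lt_max_of_lt_left (sub_pos.2 h1)) h2
  -- The corner is a boundary point; a nearby diagonal point is interior, which gives positivity on
  -- an open set.
  obtain ⟨t, ⟨ht0, ht1⟩, ht⟩ : ∃ t ∈ Ioo (1 / 2 : ℝ) 1,
      0 < coordSum d (F (WithLp.toLp 2 fun _ => t)) := by
    have hcont : Continuous fun t : ℝ => coordSum d (F (WithLp.toLp 2 fun _ => t)) := by
      fun_prop
    have h1 : ∀ᶠ t in 𝓝[<] (1 : ℝ), 0 < coordSum d (F (WithLp.toLp 2 fun _ => t)) :=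
      (hcont.continuousAt.eventually (lt_mem_nhds hone)).filter_mono nhdsWithin_le_nhds
    have h2 : ∀ᶠ t in 𝓝[<] (1 : ℝ), t ∈ Ioo (1 / 2 : ℝ) 1 :=
      Ioo_mem_nhdsLT (by norm_num)
    exact (h2.and h1).exists
  have hpos : 0 < ∫ x in C.points, coordSum d (F x) := by
    have hc : Continuous fun x => coordSum d (F x) := (coordSum d).continuous.comp hFc
    rw [setIntegral_pos_iff_support_of_nonneg_ae _ (integrableOn_points hc C)]
    · have hopen : IsOpen (Function.support (fun x => coordSum d (F x)) ∩ interior C.points) :=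
        hc.isOpen_support.inter isOpen_interior
      have hint : (WithLp.toLp 2 fun _ => t) ∈ interior C.points := by
        rw [hC]
        exact const_mem_interior_cutCubeSet (by linarith) ht1 (by nlinarith)
      have hsupp : (WithLp.toLp 2 fun _ => t) ∈ Function.support fun x => coordSum d (F x) :=
        Function.mem_support.2 ht.ne'
      exact (hopen.measure_pos volume ⟨_, hsupp, hint⟩).trans_le
        (measure_mono (inter_subset_inter_right _ interior_subset))
    · filter_upwards [ae_restrict_mem C.measurableSet_points] with x hx using hnonneg x hx
  intro hzero
  have h1 : ⨍ x in C.points, coordSum d (F x) = coordSum d (skewVector q⁻¹ C) :=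
    setAverage_clm hFc (coordSum d) C
  rw [hzero, map_zero, setAverage_eq, smul_eq_mul, mul_eq_zero] at h1
  refine h1.elim (inv_ne_zero ?_) hpos.ne'
  exact (ENNReal.toReal_pos C.volume_points_ne_zero C.volume_points_ne_top).ne'

lemma exists_skewVector_ne_zero (hd : 2 ≤ d) :
    ∃ (m : ℝ) (C : SolidBody d), skewVector m C ≠ 0 := by
  have hd' : (2 : ℝ) ≤ d := by exact_mod_cast hd
  set ε : ℝ := 1 / (4 * d) with hε
  have hdε : d * ε = 1 / 4 := by
    rw [hε]
    field_simp
  have hε₀ : 0 < ε := by positivity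
  have hε₁ : ε ≤ 1 / 8 := by nlinarith
  have hpow : ε ^ d ≤ ε ^ 2 := pow_le_pow_of_le_one hε₀.le (by linarith) hd
  have hpow₀ : 0 < ε ^ d := by positivity
  have hlt : ε < d * (1 / 2) := by linarith
  -- With `q = 1 - 2 * ε ^ d`, the centroid bound `1 / (2 * (1 - ε ^ d))` is exactly `1 / (1 + q)`.
  -- Since `d ≥ 2`, `d * (1 - q) ≤ 2 * d * ε ^ 2 = ε / 2 < ε`.
  refine ⟨(1 - 2 * ε ^ d)⁻¹, cutCube d ε hlt, skewVector_cutCube_ne_zero hlt rfl ?_ ?_ ?_ ?_ ?_⟩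
  · nlinarith
  · linarith
  · nlinarith
  · exact half_le_centroid_cutCube hlt (by linarith)
  · intro i
    have h1 : ε ^ d < 1 := by nlinarith
    have h2 := centroid_cutCube_le hlt hε₀.le h1 i
    rw [le_div_iff₀ (by linarith)] at h2
    linarith

end SolidBody

theorem theorem6p3 (d : ℕ) (hd : 2 ≤ d) :
    ∃ p₁ p₂ : SolidBody d → EuclideanSpace ℝ (Fin d),
      IsAffinePoint p₁ ∧ IsAffinePoint p₂ ∧
      (∀ C : SolidBody d, p₁ C ∈ C.points) ∧ (∀ C : SolidBody d, p₂ C ∈ C.points) ∧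
      ∃ C : SolidBody d, symmetryMeasure p₁ p₂ C = 0 := by
  obtain ⟨m, C, hv⟩ := SolidBody.exists_skewVector_ne_zero hd
  have hδ : 0 < min (C.centralGauge (SolidBody.skewVector m C)) (C.centralGauge (-SolidBody.skewVector m C)) :=
    lt_min (C.centralGauge_pos hv) (C.centralGauge_pos (neg_ne_zero.2 hv))
  obtain ⟨hne, hseg⟩ :=
    SolidBody.line_inter_points_eq_segment hv (min_le_left _ _) (min_le_right _ _)
  exact ⟨_, _, SolidBody.isAffinePoint_rayPoint m 1 hδ,
    SolidBody.isAffinePoint_rayPoint m (-1) hδ,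
    SolidBody.rayPoint_mem m 1 hδ, SolidBody.rayPoint_mem m (-1) hδ, C,
    SolidBody.symmetryMeasure_eq_zero_of_inter_eq_segment hne hseg⟩
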